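/- All Hilbert spaces are finite-dimensional with fixed orthonormal bases. Let $M$ parties be given, where party $i$ holds systems $A_i$, $\hat A_i$ and $A'_i$, and write $A_1^M=A_1\cdots A_M$, and similarly $\hat A_1^M$, $A_1^{\prime M}$. Let $\mathcal N_{A_1^M\to A_1^{\prime M}}$ be a quantum channel (a completely positive trace-preserving map) and let $\rho_{\hat A_1^M}$ be a state (positive semi-definite, trace one). For a subset $S$ of the parties, $T_S$, $T_{\hat S}$, $T_{S'}$ denote the partial transposes on the systems $A_i$, $\hat A_i$, $A'_i$ with $i\in S$. A channel $\mathcal P_{A_1^M\hat A_1^M\to A_1^{\prime M}}$ is *completely PPT-preserving* (C-PPT-P) if $T_{S'}\circ\mathcal P\circ T_{S\hat S}$ is completely positive for every subset $S$ of the parties. It simulates $\mathcal N$ by $\widetilde{\mathcal N}^{\mathcal P}(\omega)=\mathcal P(\omega\otimes\rho)$, and the simulation error is $$e_{\mathrm{PPT}}(\mathcal N,\rho)=\inf_{\mathcal P\in\text{C-PPT-P}}\tfrac12\big\|\mathcal N-\widetilde{\mathcal N}^{\mathcal P}\big\|_\diamond,\qquad \|\mathcal N-\mathcal M\|_\diamond=\sup_{\omega_{RA_1^M}}\big\|(\mathrm{id}_R\otimes\mathcal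 N)(\omega)-(\mathrm{id}_R\otimes\mathcal M)(\omega)\big\|_1,$$ where the supremum is over all finite-dimensional systems $R$ and all states $\omega$ of $RA_1^M$, and $\|X\|_1=\operatorname{Tr}\sqrt{X^\dagger X}$. The Choi operator of $\mathcal N$ is $\Gamma^{\mathcal N}_{A_1^MA_1^{\prime M}}=(\mathrm{id}\otimes\mathcal N)(|\Gamma\rangle\langle\Gamma|)$ with $|\Gamma\rangle=\sum_i|i\rangle|i\rangle$. **Proposition.** The simulation error is the value of the following (feasible) semi-definite program: $$e_{\mathrm{PPT}}(\mathcal N,\rho)=\inf\ \mu$$ over all real $\mu\ge 0$ and all operators $Z_{A_1^MA_1^{\prime M}}\ge0$ and $P_{A_1^M\hat A_1^MA_1^{\prime M}}\ge0$ such that $$\mu I_{A_1^M}\ge \operatorname{Tr}_{A_1^{\prime M}}[Z_{A_1^MA_1^{\prime M}}],\qquad \operatorname{Tr}_{A_1^{\prime M}}[P_{A_1^M\hat A_1^MA_1^{\prime M}}]=I_{A_1^M\hat A_1^M},$$ $$Z_{A_1^MA_1^{\prime M}}\ \ge\ \Gamma^{\mathcal N}_{A_1^MA_1^{\prime M}}-\operatorname{Tr}_{\hat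 A_1^M}\!\big[T_{\hat A_1^M}(\rho_{\hat A_1^M})\,P_{A_1^M\hat A_1^MA_1^{\prime M}}\big],$$ $$T_{S\hat SS'}(P_{A_1^M\hat A_1^MA_1^{\prime M}})\ge0\quad\text{for every subset } S \text{ of the parties.}$$ -/

import Mathlib

open scoped Kronecker MatrixOrder ComplexOrder

noncomputable section

namespace ChannelSim

/-- Operators on a finite-dimensional Hilbert space with an orthonormal basis indexed by `n`. -/
abbrev Op (n : Type*) := Matrix n n ℂ

/-! ### Single systems: states, channels, Choi operators, diamond distance -/

/-- A quantum state: positive semi-definite with unit trace. -/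
def IsState {n : Type*} [Fintype n] (ρ : Op n) : Prop :=
  ρ.PosSemidef ∧ ρ.trace = 1

/-- The map `id_R ⊗ Φ`, applying `Φ` to the block of `X` at each pair of basis labels of `R`. -/
def idTensor (R : Type*) {C D : Type*} (Φ : Op C →ₗ[ℂ] Op D) (X : Op (R × C)) : Op (R × D) :=
  Matrix.of fun p q => Φ (Matrix.of fun a b => X (p.1, a) (q.1, b)) p.2 q.2

/-- Complete positivity: `id_R ⊗ Φ` preserves positivity for every finite-dimensional `R`. -/
def IsCompletelyPositive {C D : Type*} (Φ : Op C →ₗ[ℂ] Op D) : Prop :=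
  ∀ (r : ℕ) (X : Op (Fin r × C)), X.PosSemidef → (idTensor (Fin r) Φ X).PosSemidef

def IsTracePreserving {C D : Type*} [Fintype C] [Fintype D] (Φ : Op C →ₗ[ℂ] Op D) : Prop :=
  ∀ X : Op C, (Φ X).trace = X.trace

/-- A quantum channel: a completely positive and trace-preserving linear map. -/
def IsChannel {C D : Type*} [Fintype C] [Fintype D] (Φ : Op C →ₗ[ℂ] Op D) : Prop :=
  IsCompletelyPositive Φ ∧ IsTracePreserving Φ

/-- The unnormalized maximally entangled operator `|Γ⟩⟨Γ|` with `|Γ⟩ = ∑ i, |i⟩|i⟩`. -/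
def maxEnt (C : Type*) [DecidableEq C] : Op (C × C) :=
  Matrix.vecMulVec (fun p => if p.1 = p.2 then 1 else 0) (fun p => if p.1 = p.2 then 1 else 0)

/-- The Choi operator `(id_R ⊗ Φ)(|Γ⟩⟨Γ|)`, with `R` a copy of the input system. -/
def choi {C D : Type*} [DecidableEq C] (Φ : Op C →ₗ[ℂ] Op D) : Op (C × D) :=
  idTensor C Φ (maxEnt C)

/-- The partial trace over the second tensor factor. -/
def traceSnd {R D : Type*} [Fintype D] (X : Op (R × D)) : Op R :=
  Matrix.of fun r s => ∑ d, X (r, d) (s, d)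

/-- The trace norm `Tr √(X† X)`. -/
def traceNorm {n : Type*} [Fintype n] [DecidableEq n] (X : Op n) : ℝ :=
  (CFC.sqrt (X.conjTranspose * X)).trace.re

/-- The diamond distance `sup ‖(id_R ⊗ Φ)(ω) - (id_R ⊗ Ψ)(ω)‖₁`, over all finite-dimensional
reference systems `R` and all states `ω` of `R` and the input system. -/
def diamondDist {C D : Type*} [Fintype C] [Fintype D] [DecidableEq D]
    (Φ Ψ : Op C →ₗ[ℂ] Op D) : ℝ :=
  sSup {t | ∃ (r : ℕ) (ω : Op (Fin r × C)), IsState ω ∧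
    t = traceNorm (idTensor (Fin r) Φ ω - idTensor (Fin r) Ψ ω)}

/-! ### Multipartite systems

The parties are the elements of a finite type `ι`, and party `i` holds a system with basis
labels `B i`; the joint system has the product basis, labelled by `∀ i, B i`. -/

section Multipartite

variable {ι : Type*} [DecidableEq ι]

/-- The partial transpose on the systems of the parties in `S`: the row and column labels
of these parties are exchanged. -/
def partialTranspose {B : ι → Type*} (S : Finset ι) : Op (∀ i, B i) →ₗ[ℂ] Op (∀ i, B i) where
  toFun X := Matrix.of fun x y => X (S.piecewise y x) (S.piecewise x y)
  map_add' _ _ := rfl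
  map_smul' _ _ := rfl

/-- The partial transpose, for an operator on the joint input and output systems, on the input
and output systems of the parties in `S`. -/
def partialTransposeInOut {B C : ι → Type*} (S : Finset ι)
    (X : Op ((∀ i, B i) × (∀ i, C i))) : Op ((∀ i, B i) × (∀ i, C i)) :=
  Matrix.of fun p q =>
    X (S.piecewise q.1 p.1, S.piecewise q.2 p.2) (S.piecewise p.1 q.1, S.piecewise p.2 q.2)

variable [Fintype ι]

/-- Completely PPT-preserving channels: channels `𝒫` such that `T_{S'} ∘ 𝒫 ∘ T_S` is completely
positive for every set `S` of parties. -/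
def IsCPPTP {B C : ι → Type*} [∀ i, Fintype (B i)] [∀ i, Fintype (C i)]
    (P : Op (∀ i, B i) →ₗ[ℂ] Op (∀ i, C i)) : Prop :=
  IsChannel P ∧
    ∀ S : Finset ι, IsCompletelyPositive (partialTranspose S ∘ₗ P ∘ₗ partialTranspose S)

variable {A Ahat A' : ι → Type*}

/-- `ω ⊗ ρ`, with its tensor factors grouped by party: party `i` holds `A i` and `Ahat i`. -/
def jointInput (ω : Op (∀ i, A i)) (ρ : Op (∀ i, Ahat i)) : Op (∀ i, A i × Ahat i) :=
  (ω ⊗ₖ ρ).submatrix (Equiv.arrowProdEquivProdArrow ι A Ahat)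
    (Equiv.arrowProdEquivProdArrow ι A Ahat)

/-- The simulation `ω ↦ 𝒫(ω ⊗ ρ)`. -/
def simulation (P : Op (∀ i, A i × Ahat i) →ₗ[ℂ] Op (∀ i, A' i)) (ρ : Op (∀ i, Ahat i)) :
    Op (∀ i, A i) →ₗ[ℂ] Op (∀ i, A' i) where
  toFun ω := P (jointInput ω ρ)
  map_add' ω ω' := by
    rw [← map_add]
    congr 1
    ext x y
    simp [jointInput, add_mul]
  map_smul' c ω := by
    rw [RingHom.id_apply, ← map_smul]
    congr 1
    ext x y
    simp [jointInput, mul_assoc]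

variable [∀ i, Fintype (A i)] [∀ i, Fintype (Ahat i)] [∀ i, Fintype (A' i)]
  [∀ i, DecidableEq (A i)] [∀ i, DecidableEq (Ahat i)] [∀ i, DecidableEq (A' i)]

/-- The error of simulating `N` with the C-PPT-P channel `P` and the resource state `ρ`. -/
def simError (N : Op (∀ i, A i) →ₗ[ℂ] Op (∀ i, A' i)) (ρ : Op (∀ i, Ahat i))
    (P : Op (∀ i, A i × Ahat i) →ₗ[ℂ] Op (∀ i, A' i)) : ℝ :=
  1 / 2 * diamondDist N (simulation P ρ)

/-- The simulation error minimized over all C-PPT-P channels. -/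
def ePPT (N : Op (∀ i, A i) →ₗ[ℂ] Op (∀ i, A' i)) (ρ : Op (∀ i, Ahat i)) : ℝ :=
  sInf {e | ∃ P : Op (∀ i, A i × Ahat i) →ₗ[ℂ] Op (∀ i, A' i), IsCPPTP P ∧ e = simError N ρ P}

/-- `Tr_Ahat [T_Ahat(ρ) P]`, where `T_Ahat(ρ)` stands for `I_A ⊗ T_Ahat(ρ) ⊗ I_A'`. -/
def contractResource (ρ : Op (∀ i, Ahat i)) (P : Op ((∀ i, A i × Ahat i) × (∀ i, A' i))) :
    Op ((∀ i, A i) × (∀ i, A' i)) :=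
  let e := (Equiv.arrowProdEquivProdArrow ι A Ahat).prodCongr (Equiv.refl (∀ i, A' i))
  let Q : Op (((∀ i, A i) × (∀ i, Ahat i)) × (∀ i, A' i)) :=
    (((1 : Op (∀ i, A i)) ⊗ₖ ρ.transpose) ⊗ₖ (1 : Op (∀ i, A' i))) * P.submatrix e.symm e.symm
  Matrix.of fun p q => ∑ h, Q ((p.1, h), p.2) ((q.1, h), q.2)

/-- The feasible points `(μ, Z, P)` of the semi-definite program. -/
structure SDPFeasible (N : Op (∀ i, A i) →ₗ[ℂ] Op (∀ i, A' i)) (ρ : Op (∀ i, Ahat i))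
    (μ : ℝ) (Z : Op ((∀ i, A i) × (∀ i, A' i)))
    (P : Op ((∀ i, A i × Ahat i) × (∀ i, A' i))) : Prop where
  mu_nonneg : 0 ≤ μ
  Z_nonneg : Z.PosSemidef
  P_nonneg : P.PosSemidef
  /-- `μ I ≥ Tr_A'[Z]` -/
  trace_le : ((μ : ℂ) • (1 : Op (∀ i, A i)) - traceSnd Z).PosSemidef
  /-- `Tr_A'[P] = I` -/
  trace_eq : traceSnd P = 1
  /-- `Z ≥ Γ^N - Tr_Ahat[T_Ahat(ρ) P]` -/
  diff_le : (Z - (choi N - contractResource ρ P)).PosSemidef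
  /-- all partial transposes of `P` are positive semi-definite -/
  ppt : ∀ S : Finset ι, (partialTransposeInOut S P).PosSemidef

end Multipartite

end ChannelSim

end

/-
The error `½‖Φ - Ψ‖⋄` is governed by a semi-definite program in the Choi operator `J` of
`Δ = Φ - Ψ`. As `Δ` annihilates traces, `½‖(id ⊗ Δ)(ω)‖₁` is the trace of the positive part of
`(id ⊗ Δ)(ω)`. If `Z ≥ 0` and `Z ≥ J`, then the map with Choi operator `Z` dominates `Δ`
completely, so this trace is at most that of the image of `ω` under that map, hence at most `μ`
when `Tr_out Z ≤ μ I`.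
Conversely, fix a faithful state `σ` and let `K` be the image of its canonical purification:
undoing the purification on `K⁺` turns it into some `Z ≥ 0`, `Z ≥ J` with
`Tr[σ Tr_out Z] = Tr K⁺`. Hence every state `σ` admits a `Z` with `Tr[σ Tr_out Z]` arbitrarily
close to `½‖Δ‖⋄`, and Sion's minimax theorem provides a single `Z` for all `σ`.
The Choi isomorphism identifies the remaining constraints with those defining C-PPT-P channels, so
the feasible values of the program are the union of those of the programs for `½‖N - Ñ‖⋄`.
-/

namespace ChannelSim

open Matrix

section PosSemidef

variable {n m : Type*} [Fintype n]

theorem re_trace_nonneg {A : Op n} (hA : A.PosSemidef) : 0 ≤ A.trace.re :=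
  (Complex.le_def.1 hA.trace_nonneg).1

theorem re_trace_mul_nonneg {A B : Op n} (hA : A.PosSemidef) (hB : B.PosSemidef) :
    0 ≤ (A * B).trace.re := by
  classical
  have hs : (CFC.sqrt A)ᴴ = CFC.sqrt A :=
    (nonneg_iff_posSemidef.1 (CFC.sqrt_nonneg A)).isHermitian
  have h := re_trace_nonneg (hB.conjTranspose_mul_mul_same (CFC.sqrt A))
  rwa [hs, trace_mul_comm, ← mul_assoc,
    CFC.sqrt_mul_sqrt_self A (nonneg_iff_posSemidef.2 hA)] at h

omit [Fintype n] in
theorem posSemidef_sum_blocks [Finite n] [Fintype m] {Y : Op (n × m)} (hY : Y.PosSemidef) :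
    (Matrix.of fun i j => ∑ a, ∑ b, Y (i, a) (j, b)).PosSemidef := by
  classical
  have := Fintype.ofFinite n
  convert hY.conjTranspose_mul_mul_same ((1 : Op n).submatrix Prod.fst id) using 1
  ext i j
  simp only [of_apply, conjTranspose_submatrix, conjTranspose_one, mul_apply, submatrix_apply,
    one_apply, id_eq, ite_mul, one_mul, zero_mul, Fintype.sum_prod_type_right, Finset.sum_ite_eq,
    Finset.mem_univ, if_true, mul_ite, mul_one, mul_zero, Finset.sum_ite_eq']
  exact Finset.sum_comm

omit [Fintype n] in
theorem norm_apply_sq_le_of_posSemidef {A : Op n} (hA : A.PosSemidef) (i j : n) :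
    ‖A i j‖ ^ 2 ≤ (A i i).re * (A j j).re := by
  have him (k : n) : (A k k).im = 0 := (Complex.le_def.1 hA.diag_nonneg).2.symm
  have hdet := (Complex.le_def.1 (hA.submatrix ![i, j]).det_nonneg).1
  simp only [det_fin_two, submatrix_apply, cons_val_zero, cons_val_one] at hdet
  rw [← hA.isHermitian.apply j i, Complex.star_def, Complex.mul_conj, Complex.normSq_eq_norm_sq,
    Complex.sub_re, Complex.mul_re, him i, him j, Complex.ofReal_re, Complex.zero_re] at hdet
  linarith

omit [Fintype n] in
theorem isClosed_setOf_posSemidef [Finite n] : IsClosed {A : Op n | A.PosSemidef} := by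
  have := Fintype.ofFinite n
  simp only [posSemidef_iff_dotProduct_mulVec, Set.ofPred_and, Set.ofPred_forall]
  refine (isClosed_eq (by fun_prop) continuous_id).inter
    (isClosed_iInter fun x => isClosed_le continuous_const ?_)
  fun_prop

variable [DecidableEq n]

-- The witness is the spectral projection onto the positive part of the spectrum.
theorem exists_mul_eq_posPart {X : Op n} (hX : X.IsHermitian) :
    ∃ Q : Op n, Q.PosSemidef ∧ (1 - Q).PosSemidef ∧ Q * X = X⁺ := by
  have hX' : IsSelfAdjoint X := hX
  have hcont (f : ℝ → ℝ) : ContinuousOn f (spectrum ℝ X) := X.finite_real_spectrum.continuousOn f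
  refine ⟨cfc (fun x : ℝ => if 0 < x then 1 else 0) X, ?_, ?_, ?_⟩
  · exact nonneg_iff_posSemidef.1 (cfc_nonneg fun x _ => by split_ifs <;> norm_num)
  · exact le_iff.1 (cfc_le_one _ _ fun x _ => by split_ifs <;> norm_num)
  · rw [CFC.posPart_def, cfcₙ_eq_cfc]
    conv_lhs => enter [2]; rw [← cfc_id ℝ X hX']
    rw [← cfc_mul _ _ X (hcont _) (hcont _)]
    congr 1
    ext x
    rcases lt_or_ge 0 x with h | h
    · simp [h, h.le]
    · simp [h, h.not_gt]

theorem re_trace_posPart_le {X Y : Op n} (hX : X.IsHermitian) (hY : Y.PosSemidef)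
    (hXY : (Y - X).PosSemidef) : (X⁺).trace.re ≤ Y.trace.re := by
  obtain ⟨Q, hQ, hQ1, hQX⟩ := exists_mul_eq_posPart hX
  have h1 := re_trace_mul_nonneg hQ hXY
  have h2 := re_trace_mul_nonneg hQ1 hY
  rw [mul_sub, hQX, trace_sub, Complex.sub_re] at h1
  rw [sub_mul, one_mul, trace_sub, Complex.sub_re] at h2
  linarith

theorem traceNorm_nonneg (X : Op n) : 0 ≤ traceNorm X :=
  re_trace_nonneg (nonneg_iff_posSemidef.1 (CFC.sqrt_nonneg (Xᴴ * X)))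

theorem half_traceNorm_eq_re_trace_posPart {X : Op n} (hX : X.IsHermitian) (h0 : X.trace = 0) :
    1 / 2 * traceNorm X = (X⁺).trace.re := by
  have habs : (CFC.abs X).trace = 2 • (X⁺).trace := by
    rw [← trace_smul, ← CFC.abs_add_self X hX, trace_add, h0, add_zero]
  have hnorm : traceNorm X = (CFC.abs X).trace.re := rfl
  rw [hnorm, habs, nsmul_eq_mul, Complex.mul_re]
  simp

theorem traceNorm_submatrix_equiv [Fintype m] [DecidableEq m] (X : Op n) (e : m ≃ n) :
    traceNorm (X.submatrix e e) = traceNorm X := by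
  set s := CFC.sqrt (Xᴴ * X)
  have hs0 : 0 ≤ s := CFC.sqrt_nonneg _
  have hs : s * s = Xᴴ * X :=
    CFC.sqrt_mul_sqrt_self _ (nonneg_iff_posSemidef.2 (posSemidef_conjTranspose_mul_self X))
  have hsqrt : CFC.sqrt ((X.submatrix e e)ᴴ * X.submatrix e e) = s.submatrix e e := by
    refine CFC.sqrt_unique ?_
      (nonneg_iff_posSemidef.2 ((nonneg_iff_posSemidef.1 hs0).submatrix e))
    rw [conjTranspose_submatrix, submatrix_mul_equiv, submatrix_mul_equiv, hs]
  rw [traceNorm, hsqrt]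
  exact congrArg Complex.re (e.sum_comp fun x => s x x)

end PosSemidef

section States

variable {C : Type*} [Fintype C]

theorem IsState.norm_apply_le_one {σ : Op C} (hσ : IsState σ) (i j : C) : ‖σ i j‖ ≤ 1 := by
  have hdiag (k : C) : 0 ≤ (σ k k).re ∧ (σ k k).re ≤ 1 := by
    have hk : σ k k ≤ σ.trace :=
      Finset.single_le_sum (f := fun k => σ k k) (fun _ _ => hσ.1.diag_nonneg) (Finset.mem_univ k)
    rw [hσ.2] at hk
    exact ⟨(Complex.le_def.1 hσ.1.diag_nonneg).1, (Complex.le_def.1 hk).1⟩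
  refine (sq_le_one_iff₀ (norm_nonneg _)).1 ((norm_apply_sq_le_of_posSemidef hσ.1 i j).trans ?_)
  exact mul_le_one₀ (hdiag i).2 (hdiag j).1 (hdiag j).2

theorem isCompact_setOf_isState : IsCompact {σ : Op C | IsState σ} := by
  have hbox : IsCompact (Set.univ.pi fun _ : C => Set.univ.pi fun _ : C =>
      Metric.closedBall (0 : ℂ) 1) :=
    isCompact_univ_pi fun _ => isCompact_univ_pi fun _ => isCompact_closedBall _ _
  refine IsCompact.of_isClosed_subset (X := Op C) hbox ?_ fun σ hσ i _ j _ => ?_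
  · exact isClosed_setOf_posSemidef.inter (isClosed_eq continuous_id.matrix_trace continuous_const)
  · simpa using hσ.norm_apply_le_one i j

theorem convex_setOf_isState : Convex ℝ {σ : Op C | IsState σ} := by
  rintro σ ⟨hσ, hσ1⟩ τ ⟨hτ, hτ1⟩ a b ha hb hab
  refine ⟨(hσ.smul ha).add (hτ.smul hb), ?_⟩
  rw [trace_add, trace_smul, trace_smul, hσ1, hτ1, ← add_smul, hab, one_smul]

theorem exists_isState_eq_smul {τ : Op C} (hτ : τ.PosSemidef) (h0 : τ ≠ 0) :
    ∃ σ, IsState σ ∧ τ = τ.trace.re • σ := by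
  have htr : (τ.trace.re : ℂ) = τ.trace :=
    Complex.ext rfl (Complex.le_def.1 hτ.trace_nonneg).2
  have hre : τ.trace.re ≠ 0 := fun h => h0 (hτ.trace_eq_zero_iff.1 (by rw [← htr, h]; rfl))
  refine ⟨τ.trace.re⁻¹ • τ, ⟨hτ.smul (inv_nonneg.2 (re_trace_nonneg hτ)), ?_⟩,
    (smul_inv_smul₀ hre τ).symm⟩
  rw [trace_smul]
  nth_rw 2 [← htr]
  rw [Complex.real_smul, ← Complex.ofReal_mul, inv_mul_cancel₀ hre, Complex.ofReal_one]

theorem posSemidef_iff_forall_isState {W : Op C} (hW : W.IsHermitian) :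
    W.PosSemidef ↔ ∀ σ, IsState σ → 0 ≤ (σ * W).trace.re := by
  refine ⟨fun h σ hσ => re_trace_mul_nonneg hσ.1 h, fun h => ?_⟩
  refine PosSemidef.of_dotProduct_mulVec_nonneg hW fun x => Complex.le_def.2
    ⟨?_, (hW.im_star_dotProduct_mulVec_self x).symm⟩
  have htr : (vecMulVec x (star x) * W).trace = star x ⬝ᵥ (W *ᵥ x) := by
    rw [vecMulVec_mul, trace_vecMulVec, dotProduct_comm, ← dotProduct_mulVec]
  rw [← htr]
  by_cases h0 : vecMulVec x (star x) = 0
  · simp [h0]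
  · have hx := posSemidef_vecMulVec_self_star x
    obtain ⟨σ, hσ, hxσ⟩ := exists_isState_eq_smul hx h0
    rw [hxσ, smul_mul_assoc, trace_smul, Complex.smul_re]
    exact smul_nonneg (re_trace_nonneg hx) (h σ hσ)

theorem posSemidef_smul_one_sub_iff [DecidableEq C] {W : Op C} (hW : W.IsHermitian) {μ : ℝ} :
    ((μ : ℂ) • (1 : Op C) - W).PosSemidef ↔ ∀ σ, IsState σ → (σ * W).trace.re ≤ μ := by
  rw [posSemidef_iff_forall_isState ((isHermitian_one.smul (Complex.conj_ofReal μ)).sub hW)]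
  refine forall₂_congr fun σ hσ => ?_
  rw [mul_sub, mul_smul_comm, mul_one, trace_sub, trace_smul, hσ.2, smul_eq_mul, mul_one,
    Complex.sub_re, Complex.ofReal_re, sub_nonneg]

theorem IsState.exists_posDef_smul_le {σ : Op C} (hσ : IsState σ) {s : ℝ} (hs0 : 0 ≤ s)
    (hs1 : s < 1) : ∃ τ : Op C, τ.PosDef ∧ IsState τ ∧ (τ - s • σ).PosSemidef := by
  classical
  have hC : Nonempty C := by
    by_contra hE
    rw [not_nonempty_iff] at hE
    exact zero_ne_one ((trace_eq_zero_of_isEmpty σ).symm.trans hσ.2)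
  have hd : (0 : ℝ) < Fintype.card C := Nat.cast_pos.2 Fintype.card_pos
  set c : ℝ := (1 - s) / Fintype.card C with hc
  have hc0 : 0 < c := div_pos (by linarith) hd
  have hpos : (s • σ + c • (1 : Op C)).PosDef :=
    PosDef.posSemidef_add (hσ.1.smul hs0) (PosDef.one.smul hc0)
  refine ⟨s • σ + c • 1, hpos, ⟨hpos.posSemidef, ?_⟩, ?_⟩
  · rw [trace_add, trace_smul, trace_smul, hσ.2, trace_one, Complex.real_smul,
      Complex.real_smul, mul_one, hc, Complex.ofReal_div, Complex.ofReal_natCast,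
      div_mul_cancel₀ _ (by exact_mod_cast hd.ne'), ← Complex.ofReal_add, add_sub_cancel,
      Complex.ofReal_one]
  · rw [add_sub_cancel_left]
    exact PosSemidef.one.smul hc0.le

end States

section IdTensor

variable {R S C D : Type*}

/-- A linear map on operators that commutes with the adjoint. Differences of completely positive
maps have this property, which makes their Choi operators self-adjoint. -/
def IsHermitianPreserving (Φ : Op C →ₗ[ℂ] Op D) : Prop :=
  ∀ X, Φ Xᴴ = (Φ X)ᴴ

theorem IsHermitianPreserving.sub {Φ Ψ : Op C →ₗ[ℂ] Op D} (hΦ : IsHermitianPreserving Φ)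
    (hΨ : IsHermitianPreserving Ψ) : IsHermitianPreserving (Φ - Ψ) := fun X => by
  rw [LinearMap.sub_apply, LinearMap.sub_apply, hΦ, hΨ, conjTranspose_sub]

theorem IsHermitianPreserving.isHermitian_idTensor {Φ : Op C →ₗ[ℂ] Op D}
    (hΦ : IsHermitianPreserving Φ) {X : Op (R × C)} (hX : X.IsHermitian) :
    (idTensor R Φ X).IsHermitian := by
  ext p q
  have hblock : (Matrix.of fun a b => X (p.1, a) (q.1, b)) =
      (Matrix.of fun a b => X (q.1, a) (p.1, b))ᴴ :=
    Matrix.ext fun a b => (hX.apply _ _).symm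
  simp only [idTensor, conjTranspose_apply, of_apply]
  rw [hblock, hΦ, conjTranspose_apply]

theorem idTensor_sub (Φ Ψ : Op C →ₗ[ℂ] Op D) (X : Op (R × C)) :
    idTensor R (Φ - Ψ) X = idTensor R Φ X - idTensor R Ψ X :=
  rfl

theorem idTensor_submatrix (Φ : Op C →ₗ[ℂ] Op D) (X : Op (R × C)) (f : S → R) :
    idTensor S Φ (X.submatrix (Prod.map f id) (Prod.map f id)) =
      (idTensor R Φ X).submatrix (Prod.map f id) (Prod.map f id) :=
  rfl

theorem kronecker_one_conj_apply [Fintype S] [Fintype C] [DecidableEq C] (M : Matrix R S ℂ)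
    (X : Op (S × C)) (p q : R × C) :
    ((M ⊗ₖ (1 : Op C)) * X * (M ⊗ₖ (1 : Op C))ᴴ) p q =
      ∑ t, ∑ u, M p.1 t * star (M q.1 u) * X (t, p.2) (u, q.2) := by
  simp only [mul_apply, conjTranspose_apply, Fintype.sum_prod_type, kroneckerMap_apply, one_apply,
    mul_ite, mul_one, mul_zero, ite_mul, zero_mul, apply_ite star, star_zero, Finset.sum_ite_eq,
    Finset.mem_univ, if_true, Finset.sum_mul]
  rw [Finset.sum_comm]
  exact Finset.sum_congr rfl fun _ _ => Finset.sum_congr rfl fun _ _ => mul_right_comm _ _ _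

theorem idTensor_kronecker_one_conj [Fintype S] [Fintype C] [Fintype D] [DecidableEq C]
    [DecidableEq D] (Φ : Op C →ₗ[ℂ] Op D) (M : Matrix R S ℂ) (X : Op (S × C)) :
    idTensor R Φ ((M ⊗ₖ (1 : Op C)) * X * (M ⊗ₖ (1 : Op C))ᴴ) =
      (M ⊗ₖ (1 : Op D)) * idTensor S Φ X * (M ⊗ₖ (1 : Op D))ᴴ := by
  ext ⟨r, d⟩ ⟨s, e⟩
  have hblock : (Matrix.of fun a b => ((M ⊗ₖ (1 : Op C)) * X * (M ⊗ₖ (1 : Op C))ᴴ) (r, a) (s, b)) =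
      ∑ t, ∑ u, (M r t * star (M s u)) • Matrix.of fun a b => X (t, a) (u, b) := by
    ext a b
    simp only [of_apply, kronecker_one_conj_apply, Matrix.sum_apply, Matrix.smul_apply,
      smul_eq_mul]
  rw [kronecker_one_conj_apply]
  simp only [idTensor, of_apply, hblock, map_sum, map_smul, Matrix.sum_apply, Matrix.smul_apply,
    smul_eq_mul]

end IdTensor

section Choi

variable {R C D : Type*} [DecidableEq C]

theorem choi_sub (Φ Ψ : Op C →ₗ[ℂ] Op D) : choi (Φ - Ψ) = choi Φ - choi Ψ :=
  rfl

theorem choi_apply (Φ : Op C →ₗ[ℂ] Op D) (p q : C × D) :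
    choi Φ p q = Φ (Matrix.single p.1 q.1 1) p.2 q.2 := by
  simp only [choi, idTensor, maxEnt, of_apply, vecMulVec_apply]
  refine congrArg (fun X => Φ X p.2 q.2) (Matrix.ext fun a b => ?_)
  rw [of_apply, single_apply, ite_and, ite_mul, one_mul, zero_mul]

theorem maxEnt_posSemidef [Finite C] : (maxEnt C).PosSemidef := by
  convert posSemidef_vecMulVec_self_star fun p : C × C => if p.1 = p.2 then (1 : ℂ) else 0 using 1
  rw [maxEnt]
  congr
  ext p
  simp [apply_ite star]

theorem apply_eq_sum_choi [Fintype C] (Φ : Op C →ₗ[ℂ] Op D) (X : Op C) (d e : D) :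
    Φ X d e = ∑ a, ∑ b, X a b * choi Φ (a, d) (b, e) := by
  have hsingle (a b : C) : single a b (X a b) = X a b • single a b 1 := by
    rw [smul_single, smul_eq_mul, mul_one]
  conv_lhs => rw [matrix_eq_sum_single X]
  simp only [hsingle, map_sum, map_smul, Matrix.sum_apply, Matrix.smul_apply, smul_eq_mul,
    choi_apply]

/-- The linear map with Choi operator `J`. -/
def ofChoi [Fintype C] (J : Op (C × D)) : Op C →ₗ[ℂ] Op D where
  toFun X := Matrix.of fun d e => ∑ a, ∑ b, X a b * J (a, d) (b, e)
  map_add' X Y := by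
    ext d e
    simp only [Matrix.add_apply, of_apply, add_mul, Finset.sum_add_distrib]
  map_smul' c X := by
    ext d e
    simp only [Matrix.smul_apply, of_apply, smul_eq_mul, Finset.mul_sum, mul_assoc,
      RingHom.id_apply]

theorem choi_ofChoi [Fintype C] (J : Op (C × D)) : choi (ofChoi J) = J := by
  ext ⟨a, d⟩ ⟨b, e⟩
  simp [choi_apply, ofChoi, single_apply, ite_and, Finset.sum_ite_irrel]

variable [Finite C]

theorem isHermitianPreserving_iff_choi (Φ : Op C →ₗ[ℂ] Op D) :
    IsHermitianPreserving Φ ↔ (choi Φ).IsHermitian := by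
  refine ⟨fun h => h.isHermitian_idTensor maxEnt_posSemidef.isHermitian, fun h X => ?_⟩
  have := Fintype.ofFinite C
  ext d e
  simp only [conjTranspose_apply, apply_eq_sum_choi Φ, star_sum, star_mul', h.apply]
  exact Finset.sum_comm

variable [Finite D]

theorem idTensor_posSemidef [Finite R] {Φ : Op C →ₗ[ℂ] Op D}
    (hΦ : (choi Φ).PosSemidef) {X : Op (R × C)} (hX : X.PosSemidef) :
    (idTensor R Φ X).PosSemidef := by
  have := Fintype.ofFinite C
  convert posSemidef_sum_blocks ((hX.kronecker hΦ).submatrix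
    fun x : (R × D) × C => ((x.1.1, x.2), (x.2, x.1.2))) using 1
  ext p q
  exact apply_eq_sum_choi Φ _ _ _

theorem isCompletelyPositive_iff_choi (Φ : Op C →ₗ[ℂ] Op D) :
    IsCompletelyPositive Φ ↔ (choi Φ).PosSemidef := by
  refine ⟨fun h => ?_, fun h r X hX => idTensor_posSemidef h hX⟩
  have := Fintype.ofFinite C
  let e := Fintype.equivFin C
  have hcopy := (h _ _ (maxEnt_posSemidef (C := C) |>.submatrix (Prod.map e.symm id))).submatrix
    (Prod.map e id)
  rwa [idTensor_submatrix, submatrix_submatrix, Prod.map_comp_map, e.symm_comp_self,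
    Function.comp_id, Prod.map_id, submatrix_id_id] at hcopy

omit [DecidableEq C] in
theorem IsCompletelyPositive.isHermitianPreserving {Φ : Op C →ₗ[ℂ] Op D}
    (hΦ : IsCompletelyPositive Φ) : IsHermitianPreserving Φ := by
  classical
  exact (isHermitianPreserving_iff_choi Φ).2 ((isCompletelyPositive_iff_choi Φ).1 hΦ).isHermitian

end Choi

section Traces

variable {R C D : Type*} [Fintype D]

theorem traceSnd_isHermitian {X : Op (C × D)} (hX : X.IsHermitian) : (traceSnd X).IsHermitian := by
  ext a b
  simp only [traceSnd, conjTranspose_apply, of_apply, star_sum, hX.apply]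

theorem traceSnd_posSemidef {X : Op (C × D)} (hX : X.PosSemidef) :
    (traceSnd X).PosSemidef := by
  have hsum : traceSnd X = ∑ d, X.submatrix (·, d) (·, d) := by
    ext a b
    simp only [traceSnd, of_apply, Matrix.sum_apply, submatrix_apply]
  exact hsum ▸ posSemidef_sum _ fun d _ => hX.submatrix _

theorem trace_idTensor [Fintype R] (Φ : Op C →ₗ[ℂ] Op D) (X : Op (R × C)) :
    (idTensor R Φ X).trace = (Φ (traceSnd (X.submatrix Prod.swap Prod.swap))).trace := by
  have hsum : traceSnd (X.submatrix Prod.swap Prod.swap) =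
      ∑ r, Matrix.of fun a b => X (r, a) (r, b) := by
    ext a b
    simp only [traceSnd, of_apply, Matrix.sum_apply, submatrix_apply, Prod.swap_prod_mk]
  rw [hsum, map_sum, trace_sum]
  simp only [Matrix.trace, diag_apply, Fintype.sum_prod_type, idTensor, of_apply]

variable [Fintype C]

theorem trace_traceSnd (X : Op (C × D)) : (traceSnd X).trace = X.trace := by
  simp only [Matrix.trace, diag_apply, traceSnd, of_apply, Fintype.sum_prod_type]

theorem IsState.traceSnd {ω : Op (C × D)} (hω : IsState ω) : IsState (traceSnd ω) :=
  ⟨traceSnd_posSemidef hω.1, (trace_traceSnd ω).trans hω.2⟩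

theorem IsState.submatrix_equiv {ω : Op C} (hω : IsState ω) (e : D ≃ C) :
    IsState (ω.submatrix e e) :=
  ⟨hω.1.submatrix e, (e.sum_comp fun c => ω c c).trans hω.2⟩

theorem IsState.transpose {σ : Op C} (hσ : IsState σ) : IsState σᵀ :=
  ⟨hσ.1.transpose, (trace_transpose σ).trans hσ.2⟩

theorem IsTracePreserving.nonempty {Φ : Op C →ₗ[ℂ] Op D}
    (hΦ : IsTracePreserving Φ) : Nonempty C → Nonempty D := by
  classical
  rintro ⟨c⟩
  by_contra hD
  rw [not_nonempty_iff] at hD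
  have htrace := hΦ (single c c 1)
  rw [trace_single_eq_same, trace_eq_zero_of_isEmpty] at htrace
  exact zero_ne_one htrace

theorem trace_mul_traceSnd [DecidableEq D] (σ : Op C) (Z : Op (C × D)) :
    (σ * traceSnd Z).trace = ((σ ⊗ₖ (1 : Op D)) * Z).trace := by
  simp only [Matrix.trace, diag_apply, mul_apply, traceSnd, of_apply, Finset.mul_sum,
    Fintype.sum_prod_type, kroneckerMap_apply, one_apply, mul_ite, mul_one, mul_zero, ite_mul,
    zero_mul, Finset.sum_ite_eq, Finset.mem_univ, if_true]
  exact Finset.sum_congr rfl fun _ _ => Finset.sum_comm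

variable [DecidableEq C]

theorem traceSnd_maxEnt : traceSnd (maxEnt C) = 1 := by
  ext a b
  simp [traceSnd, maxEnt, vecMulVec_apply, one_apply]

theorem trace_apply (Φ : Op C →ₗ[ℂ] Op D) (X : Op C) :
    (Φ X).trace = (Xᵀ * traceSnd (choi Φ)).trace := by
  simp only [Matrix.trace, diag_apply, apply_eq_sum_choi Φ, mul_apply, transpose_apply, traceSnd,
    of_apply, Finset.mul_sum]
  rw [Finset.sum_comm]
  conv_rhs => rw [Finset.sum_comm]
  exact Finset.sum_congr rfl fun _ _ => Finset.sum_comm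

theorem isTracePreserving_iff_choi (Φ : Op C →ₗ[ℂ] Op D) :
    IsTracePreserving Φ ↔ traceSnd (choi Φ) = 1 := by
  rw [ext_iff_trace_mul_left]
  refine ⟨fun h X => ?_, fun h X => ?_⟩
  · rw [← transpose_transpose X, ← trace_apply, h, trace_transpose, transpose_transpose, mul_one]
  · rw [trace_apply, h, mul_one, trace_transpose]

end Traces

section Minimax

variable {E F : Type*} [AddCommGroup E] [Module ℝ E] [TopologicalSpace E]
  [IsTopologicalAddGroup E] [ContinuousSMul ℝ E] [T2Space E] [FiniteDimensional ℝ E]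
  [AddCommGroup F] [Module ℝ F] [TopologicalSpace F] [IsTopologicalAddGroup F]
  [ContinuousSMul ℝ F] [T2Space F] [FiniteDimensional ℝ F]

-- Compactness of `X` leaves finitely many `y` to choose from, so `Y` need not be compact.
theorem exists_forall_lt_of_forall_exists_lt (B : E →ₗ[ℝ] F →ₗ[ℝ] ℝ) {X : Set E} {Y : Set F}
    {t : ℝ} (hX : IsCompact X) (cX : Convex ℝ X) (cY : Convex ℝ Y) (hY : Y.Nonempty)
    (h : ∀ x ∈ X, ∃ y ∈ Y, t < B x y) : ∃ y ∈ Y, ∀ x ∈ X, t < B x y := by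
  obtain rfl | hX₀ := X.eq_empty_or_nonempty
  · exact hY.imp fun y hy => ⟨hy, fun _ hx => absurd hx (Set.notMem_empty _)⟩
  have hleft (y : F) : Continuous fun x => B x y := (B.flip y).continuous_of_finiteDimensional
  have hright (x : E) : Continuous fun y => B x y := (B x).continuous_of_finiteDimensional
  choose! y hyY hy using h
  obtain ⟨T, hTX, hT⟩ := hX.elim_nhds_subcover (fun x => {x' | t < B x' (y x)}) fun x hx =>
    (isOpen_lt continuous_const (hleft _)).mem_nhds (hy x hx)
  refine Sion.exists_lt_iInf_of_lt_iInf_of_finite hX₀ hX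
    (fun y _ => (hleft y).lowerSemicontinuous.lowerSemicontinuousOn X)
    (fun y _ => ((B.flip y).convexOn cX).quasiconvexOn) cY
    (fun x _ => (hright x).upperSemicontinuous.upperSemicontinuousOn Y)
    (fun x _ => ((B x).concaveOn cY).quasiconcaveOn) cX (T.finite_toSet.image y)
    (Set.image_subset_iff.2 fun x hx => hyY x (hTX x hx)) fun x hx => ?_
  obtain ⟨x', hx'T, hx'⟩ := Set.mem_iUnion₂.1 (hT hx)
  exact ⟨y x', Set.mem_image_of_mem y hx'T, hx'⟩

end Minimax

theorem diamondDist_nonneg {C D : Type*} [Fintype C] [Fintype D] [DecidableEq D]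
    (Φ Ψ : Op C →ₗ[ℂ] Op D) : 0 ≤ diamondDist Φ Ψ :=
  Real.sSup_nonneg (by rintro _ ⟨r, ω, -, rfl⟩; exact traceNorm_nonneg _)

section DiamondDuality

variable {R C D : Type*} [Fintype C] [Fintype D] [DecidableEq C]

/-- A feasible point `(μ, Z)` of the dual semi-definite program for the diamond distance: here `J`
is the Choi operator of the difference of two channels, and `μ` bounds half of the distance. -/
structure IsDiamondCertificate (J : Op (C × D)) (μ : ℝ) (Z : Op (C × D)) : Prop where
  posSemidef : Z.PosSemidef
  sub_posSemidef : (Z - J).PosSemidef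
  traceSnd_le : ((μ : ℂ) • (1 : Op C) - traceSnd Z).PosSemidef

omit [Fintype C] in
theorem exists_isDiamondCertificate [Finite C] {J : Op (C × D)} (hJ : J.IsHermitian) :
    ∃ μ Z, 0 ≤ μ ∧ IsDiamondCertificate J μ Z := by
  classical
  have := Fintype.ofFinite C
  have hpos := nonneg_iff_posSemidef.1 (CFC.posPart_nonneg J)
  have hcont : Continuous fun σ : Op C => (σ * traceSnd J⁺).trace.re := by fun_prop
  obtain ⟨b, hb⟩ := (isCompact_setOf_isState (C := C)).bddAbove_image hcont.continuousOn
  refine ⟨max b 0, J⁺, le_max_right _ _, hpos, le_iff.1 (CFC.le_posPart hJ), ?_⟩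
  exact (posSemidef_smul_one_sub_iff (traceSnd_isHermitian hpos.isHermitian)).2 fun σ hσ =>
    (hb (Set.mem_image_of_mem _ hσ)).trans (le_max_left _ _)

variable {Δ : Op C →ₗ[ℂ] Op D}

theorem IsDiamondCertificate.half_traceNorm_le [Fintype R] [DecidableEq R] [DecidableEq D]
    {μ : ℝ} {Z : Op (C × D)} (hZ : IsDiamondCertificate (choi Δ) μ Z)
    (hΔ : IsHermitianPreserving Δ) (hΔ₀ : ∀ X, (Δ X).trace = 0) {ω : Op (R × C)}
    (hω : IsState ω) : 1 / 2 * traceNorm (idTensor R Δ ω) ≤ μ := by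
  have hJ : choi (ofChoi Z - Δ) = Z - choi Δ := by rw [choi_sub, choi_ofChoi]
  have hdom : (idTensor R (ofChoi Z) ω - idTensor R Δ ω).PosSemidef := by
    rw [← idTensor_sub]
    exact idTensor_posSemidef (hJ ▸ hZ.sub_posSemidef) hω.1
  have hout : (idTensor R (ofChoi Z) ω).PosSemidef :=
    idTensor_posSemidef ((choi_ofChoi Z).symm ▸ hZ.posSemidef) hω.1
  have hmarginal := (hω.submatrix_equiv (Equiv.prodComm C R)).traceSnd.transpose
  have hherm := hΔ.isHermitian_idTensor hω.1.isHermitian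
  calc 1 / 2 * traceNorm (idTensor R Δ ω) = ((idTensor R Δ ω)⁺).trace.re :=
        half_traceNorm_eq_re_trace_posPart hherm (by rw [trace_idTensor, hΔ₀])
    _ ≤ (idTensor R (ofChoi Z) ω).trace.re := re_trace_posPart_le hherm hout hdom
    _ = ((traceSnd (ω.submatrix Prod.swap Prod.swap))ᵀ * traceSnd Z).trace.re := by
        rw [trace_idTensor, trace_apply, choi_ofChoi]
    _ ≤ μ := (posSemidef_smul_one_sub_iff
        (traceSnd_isHermitian hZ.posSemidef.isHermitian)).1 hZ.traceSnd_le _ hmarginal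

theorem exists_conj_eq_posPart {n : Type*} [Fintype n] [DecidableEq n] {M J : Op n}
    (hM : IsUnit M) (hJ : J.IsHermitian) :
    ∃ Z : Op n, Z.PosSemidef ∧ (Z - J).PosSemidef ∧ M * Z * Mᴴ = (M * J * Mᴴ)⁺ := by
  set K := M * J * Mᴴ
  have hK : K.IsHermitian := isHermitian_mul_mul_conjTranspose M hJ
  have hMdet := (isUnit_iff_isUnit_det M).1 hM
  have hconj (X : Op n) : M * (M⁻¹ * X * M⁻¹ᴴ) * Mᴴ = X := by
    rw [mul_assoc, mul_assoc, mul_assoc, ← conjTranspose_mul, mul_nonsing_inv M hMdet,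
      conjTranspose_one, mul_one, mul_nonsing_inv_cancel_left M X hMdet]
  have hpos (X : Op n) : (M * X * Mᴴ).PosSemidef ↔ X.PosSemidef :=
    hM.posSemidef_star_right_conjugate_iff
  refine ⟨M⁻¹ * K⁺ * M⁻¹ᴴ, ?_, ?_, hconj _⟩
  · rw [← hpos, hconj]
    exact nonneg_iff_posSemidef.1 (CFC.posPart_nonneg K)
  · rw [← hpos, mul_sub, sub_mul, hconj]
    exact le_iff.1 (CFC.le_posPart hK)

/-- The canonical purification `(√σ ⊗ I)|Γ⟩⟨Γ|(√σ ⊗ I)` of `σ`. -/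
noncomputable def purification (σ : Op C) : Op (C × C) :=
  (CFC.sqrt σ ⊗ₖ (1 : Op C)) * maxEnt C * (CFC.sqrt σ ⊗ₖ (1 : Op C))ᴴ

theorem sqrt_kronecker_one_mul_self [DecidableEq D] {σ : Op C} (hσ : σ.PosSemidef) :
    (CFC.sqrt σ ⊗ₖ (1 : Op D))ᴴ * (CFC.sqrt σ ⊗ₖ (1 : Op D)) = σ ⊗ₖ (1 : Op D) := by
  have hs : (CFC.sqrt σ)ᴴ = CFC.sqrt σ :=
    (nonneg_iff_posSemidef.1 (CFC.sqrt_nonneg σ)).isHermitian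
  rw [conjTranspose_kronecker, ← mul_kronecker_mul, hs, conjTranspose_one, mul_one,
    CFC.sqrt_mul_sqrt_self σ (nonneg_iff_posSemidef.2 hσ)]

theorem IsState.purification {σ : Op C} (hσ : IsState σ) : IsState (purification σ) := by
  refine ⟨maxEnt_posSemidef.mul_mul_conjTranspose_same _, ?_⟩
  rw [ChannelSim.purification, trace_mul_comm, ← mul_assoc, sqrt_kronecker_one_mul_self hσ.1,
    ← trace_mul_traceSnd, traceSnd_maxEnt, mul_one, hσ.2]

theorem exists_re_trace_eq_of_posDef [DecidableEq D] (hΔ : IsHermitianPreserving Δ)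
    (hΔ₀ : ∀ X, (Δ X).trace = 0) {σ : Op C} (hσ : σ.PosDef) (hσ₁ : σ.trace = 1) :
    ∃ Z, Z.PosSemidef ∧ (Z - choi Δ).PosSemidef ∧
      (σ * traceSnd Z).trace.re = 1 / 2 * traceNorm (idTensor C Δ (purification σ)) := by
  set M := CFC.sqrt σ ⊗ₖ (1 : Op D)
  have hMM : Mᴴ * M = σ ⊗ₖ (1 : Op D) := sqrt_kronecker_one_mul_self hσ.posSemidef
  have hM : IsUnit M := isUnit_of_mul_isUnit_right (hMM ▸ (hσ.kronecker PosDef.one).isUnit)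
  have hK : idTensor C Δ (purification σ) = M * choi Δ * Mᴴ := idTensor_kronecker_one_conj Δ _ _
  have hω : IsState (purification σ) := IsState.purification ⟨hσ.posSemidef, hσ₁⟩
  obtain ⟨Z, hZ, hZΔ, hMZ⟩ :=
    exists_conj_eq_posPart hM ((isHermitianPreserving_iff_choi Δ).1 hΔ)
  refine ⟨Z, hZ, hZΔ, ?_⟩
  rw [half_traceNorm_eq_re_trace_posPart (hΔ.isHermitian_idTensor hω.1.isHermitian)
    (by rw [trace_idTensor, hΔ₀]), hK, ← hMZ, trace_mul_traceSnd, ← hMM, mul_assoc,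
    trace_mul_comm]

variable {Φ Ψ : Op C →ₗ[ℂ] Op D}

theorem IsDiamondCertificate.half_diamondDist_le [DecidableEq D] {μ : ℝ} {Z : Op (C × D)}
    (hZ : IsDiamondCertificate (choi (Φ - Ψ)) μ Z) (hμ : 0 ≤ μ)
    (hΔ : IsHermitianPreserving (Φ - Ψ)) (hΔ₀ : ∀ X, ((Φ - Ψ) X).trace = 0) :
    1 / 2 * diamondDist Φ Ψ ≤ μ := by
  have hle : diamondDist Φ Ψ ≤ 2 * μ := by
    refine Real.sSup_le ?_ (by positivity)
    rintro _ ⟨r, ω, hω, rfl⟩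
    rw [← idTensor_sub]
    linarith [hZ.half_traceNorm_le hΔ hΔ₀ hω]
  linarith

omit [DecidableEq C] in
theorem traceNorm_idTensor_le_diamondDist [Fintype R] [DecidableEq R] [DecidableEq D]
    (hΔ : IsHermitianPreserving (Φ - Ψ)) (hΔ₀ : ∀ X, ((Φ - Ψ) X).trace = 0) {ω : Op (R × C)}
    (hω : IsState ω) : traceNorm (idTensor R (Φ - Ψ) ω) ≤ diamondDist Φ Ψ := by
  classical
  obtain ⟨b, Z, -, hZ⟩ := exists_isDiamondCertificate ((isHermitianPreserving_iff_choi _).1 hΔ)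
  let e := (Fintype.equivFin R).symm
  refine le_csSup ⟨2 * b, ?_⟩ ⟨_, _, hω.submatrix_equiv (e.prodCongr (.refl C)), ?_⟩
  · rintro _ ⟨r, ω, hω, rfl⟩
    rw [← idTensor_sub]
    linarith [hZ.half_traceNorm_le hΔ hΔ₀ hω]
  · exact (traceNorm_submatrix_equiv _ (e.prodCongr (.refl D))).symm

theorem exists_re_trace_lt [DecidableEq D]
    (hΔ : IsHermitianPreserving (Φ - Ψ)) (hΔ₀ : ∀ X, ((Φ - Ψ) X).trace = 0) {μ : ℝ}
    (hμ : 1 / 2 * diamondDist Φ Ψ < μ) {σ : Op C} (hσ : IsState σ) :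
    ∃ Z, Z.PosSemidef ∧ (Z - choi (Φ - Ψ)).PosSemidef ∧ (σ * traceSnd Z).trace.re < μ := by
  have hd := diamondDist_nonneg Φ Ψ
  have hμ₀ : 0 < μ := by linarith
  obtain ⟨s, hs, hs₁⟩ := exists_between ((div_lt_one hμ₀).2 hμ)
  have hs₀ : 0 < s := hs.trans_le' (by positivity)
  obtain ⟨τ, hτ, hτ₁, hτσ⟩ := hσ.exists_posDef_smul_le hs₀.le hs₁
  obtain ⟨Z, hZ, hZΔ, hτZ⟩ := exists_re_trace_eq_of_posDef hΔ hΔ₀ hτ hτ₁.2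
  refine ⟨Z, hZ, hZΔ, lt_of_mul_lt_mul_left ?_ hs₀.le⟩
  have hmono := re_trace_mul_nonneg hτσ (traceSnd_posSemidef hZ)
  rw [sub_mul, trace_sub, Complex.sub_re, smul_mul_assoc, trace_smul, Complex.smul_re,
    smul_eq_mul] at hmono
  have hnorm := traceNorm_idTensor_le_diamondDist hΔ hΔ₀ hτ₁.purification
  linarith [(div_lt_iff₀ hμ₀).1 hs]

/-- The real bilinear form `(σ, Z) ↦ Re Tr[σ Tr_D Z]` over which the minimax is taken. -/
noncomputable def tracePairing : Op C →ₗ[ℝ] Op (C × D) →ₗ[ℝ] ℝ :=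
  LinearMap.mk₂ ℝ (fun σ Z => (σ * traceSnd Z).trace.re)
    (fun σ τ Z => by simp only [add_mul, trace_add, Complex.add_re])
    (fun c σ Z => by simp only [smul_mul_assoc, trace_smul, Complex.smul_re])
    (fun σ Z W => by
      classical simp only [trace_mul_traceSnd, mul_add, trace_add, Complex.add_re])
    (fun c σ Z => by
      classical simp only [trace_mul_traceSnd, mul_smul_comm, trace_smul, Complex.smul_re])

theorem exists_isDiamondCertificate_of_lt [DecidableEq D]
    (hΔ : IsHermitianPreserving (Φ - Ψ)) (hΔ₀ : ∀ X, ((Φ - Ψ) X).trace = 0) {μ : ℝ}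
    (hμ : 1 / 2 * diamondDist Φ Ψ < μ) : ∃ Z, IsDiamondCertificate (choi (Φ - Ψ)) μ Z := by
  let Y := {Z : Op (C × D) | Z.PosSemidef ∧ (Z - choi (Φ - Ψ)).PosSemidef}
  have cY : Convex ℝ Y := by
    rintro Z ⟨hZ, hZJ⟩ W ⟨hW, hWJ⟩ a b ha hb hab
    refine ⟨(hZ.smul ha).add (hW.smul hb), ?_⟩
    convert (hZJ.smul ha).add (hWJ.smul hb) using 1
    rw [smul_sub, smul_sub, sub_add_sub_comm, ← add_smul, hab, one_smul]
  have hY : Y.Nonempty := by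
    obtain ⟨_, Z, -, hZ⟩ := exists_isDiamondCertificate ((isHermitianPreserving_iff_choi _).1 hΔ)
    exact ⟨Z, hZ.posSemidef, hZ.sub_posSemidef⟩
  obtain ⟨Z, ⟨hZ, hZΔ⟩, hle⟩ := exists_forall_lt_of_forall_exists_lt (-tracePairing)
    isCompact_setOf_isState convex_setOf_isState cY hY (t := -μ) fun σ hσ => by
      obtain ⟨Z, hZ, hZΔ, hlt⟩ := exists_re_trace_lt hΔ hΔ₀ hμ hσ
      exact ⟨Z, ⟨hZ, hZΔ⟩, neg_lt_neg hlt⟩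
  exact ⟨Z, hZ, hZΔ, (posSemidef_smul_one_sub_iff (traceSnd_isHermitian hZ.isHermitian)).2
    fun σ hσ => (neg_lt_neg_iff.1 (hle σ hσ)).le⟩

theorem isGLB_half_diamondDist [DecidableEq D]
    (hΔ : IsHermitianPreserving (Φ - Ψ)) (hΔ₀ : ∀ X, ((Φ - Ψ) X).trace = 0) :
    IsGLB {μ | 0 ≤ μ ∧ ∃ Z, IsDiamondCertificate (choi (Φ - Ψ)) μ Z}
      (1 / 2 * diamondDist Φ Ψ) := by
  refine ⟨fun μ ⟨hμ, Z, hZ⟩ => hZ.half_diamondDist_le hμ hΔ hΔ₀, fun b hb => ?_⟩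
  refine le_of_forall_gt_imp_ge_of_dense fun μ hμ => hb ⟨?_, ?_⟩
  · exact (mul_nonneg one_half_pos.le (diamondDist_nonneg Φ Ψ)).trans hμ.le
  · exact exists_isDiamondCertificate_of_lt hΔ hΔ₀ hμ

end DiamondDuality

section PartialTranspose

variable {ι : Type*} [DecidableEq ι] {B C : ι → Type*}

theorem piecewise_piecewise_swap (S : Finset ι) (x y : ∀ i, B i) :
    S.piecewise (S.piecewise x y) (S.piecewise y x) = x := by
  rw [Finset.piecewise_idem_left, Finset.piecewise_idem_right, Finset.piecewise_same]

theorem piecewise_eq_piecewise_swap_iff (S : Finset ι) (x y : ∀ i, B i) :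
    S.piecewise y x = S.piecewise x y ↔ x = y := by
  refine ⟨fun h => ?_, fun h => by rw [h]⟩
  have hx := piecewise_piecewise_swap S x y
  have hy := piecewise_piecewise_swap S y x
  rw [h, Finset.piecewise_same] at hx hy
  exact hx.symm.trans hy

variable [Fintype ι] [∀ i, DecidableEq (B i)]

theorem partialTranspose_single (S : Finset ι) (a b : ∀ i, B i) :
    partialTranspose S (Matrix.single a b (1 : ℂ)) =
      Matrix.single (S.piecewise b a) (S.piecewise a b) 1 := by
  ext x y
  change (if _ then _ else _) = (if _ then _ else _)
  refine if_congr ⟨?_, ?_⟩ rfl rfl <;> rintro ⟨rfl, rfl⟩ <;>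
    simp only [piecewise_piecewise_swap, and_self]

theorem choi_partialTranspose (S : Finset ι) (P : Op (∀ i, B i) →ₗ[ℂ] Op (∀ i, C i)) :
    choi (partialTranspose S ∘ₗ P ∘ₗ partialTranspose S) = partialTransposeInOut S (choi P) := by
  ext p q
  rw [choi_apply, LinearMap.comp_apply, LinearMap.comp_apply, partialTranspose_single]
  simp only [partialTransposeInOut, of_apply, choi_apply]
  rfl

theorem partialTransposeInOut_smul_one [∀ i, DecidableEq (C i)] (S : Finset ι) (c : ℝ) :
    partialTransposeInOut S (c • (1 : Op ((∀ i, B i) × (∀ i, C i)))) = c • 1 := by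
  ext p q
  simp only [partialTransposeInOut, of_apply, Matrix.smul_apply, one_apply, Prod.ext_iff,
    piecewise_eq_piecewise_swap_iff]

variable [∀ i, Fintype (B i)] [∀ i, Fintype (C i)]

theorem isCPPTP_iff_choi (P : Op (∀ i, B i) →ₗ[ℂ] Op (∀ i, C i)) :
    IsCPPTP P ↔ (choi P).PosSemidef ∧ traceSnd (choi P) = 1 ∧
      ∀ S : Finset ι, (partialTransposeInOut S (choi P)).PosSemidef := by
  simp only [IsCPPTP, IsChannel, isCompletelyPositive_iff_choi, isTracePreserving_iff_choi,
    choi_partialTranspose, and_assoc]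

omit [∀ i, DecidableEq (B i)] in
theorem exists_isCPPTP (h : Nonempty (∀ i, B i) → Nonempty (∀ i, C i)) :
    ∃ P : Op (∀ i, B i) →ₗ[ℂ] Op (∀ i, C i), IsCPPTP P := by
  classical
  -- The channel with constant output the maximally mixed state.
  let c : ℝ := (Fintype.card (∀ i, C i) : ℝ)⁻¹
  have hc : (c • (1 : Op ((∀ i, B i) × (∀ i, C i)))).PosSemidef :=
    PosSemidef.one.smul (inv_nonneg.2 (Nat.cast_nonneg _))
  refine ⟨ofChoi (c • 1), (isCPPTP_iff_choi _).2 ?_⟩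
  rw [choi_ofChoi]
  refine ⟨hc, ?_, fun S => by rwa [partialTransposeInOut_smul_one]⟩
  ext a b
  have := h ⟨a⟩
  by_cases hab : a = b <;> simp [traceSnd, c, one_apply, hab, -Fintype.card_pi]

end PartialTranspose

section Simulation

variable {ι : Type*} {A Ahat A' : ι → Type*}

theorem jointInput_conjTranspose (ω : Op (∀ i, A i)) (ρ : Op (∀ i, Ahat i)) :
    (jointInput ω ρ)ᴴ = jointInput ωᴴ ρᴴ := by
  rw [jointInput, conjTranspose_submatrix, conjTranspose_kronecker, jointInput]

theorem simulation_isHermitianPreserving {P : Op (∀ i, A i × Ahat i) →ₗ[ℂ] Op (∀ i, A' i)}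
    {ρ : Op (∀ i, Ahat i)} (hP : IsHermitianPreserving P) (hρ : ρ.IsHermitian) :
    IsHermitianPreserving (simulation P ρ) := fun ω => by
  change P (jointInput ωᴴ ρ) = (P (jointInput ω ρ))ᴴ
  rw [← hP, jointInput_conjTranspose, hρ.eq]

variable [Fintype ι] [DecidableEq ι] [∀ i, Fintype (A i)] [∀ i, Fintype (Ahat i)]

theorem trace_jointInput (ω : Op (∀ i, A i)) (ρ : Op (∀ i, Ahat i)) :
    (jointInput ω ρ).trace = ω.trace * ρ.trace := by
  rw [← trace_kronecker]
  exact (Equiv.arrowProdEquivProdArrow ι A Ahat).sum_comp fun x => (ω ⊗ₖ ρ) x x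

variable [∀ i, Fintype (A' i)]

theorem simulation_isTracePreserving {P : Op (∀ i, A i × Ahat i) →ₗ[ℂ] Op (∀ i, A' i)}
    {ρ : Op (∀ i, Ahat i)} (hP : IsTracePreserving P) (hρ : ρ.trace = 1) :
    IsTracePreserving (simulation P ρ) := fun ω =>
  (hP (jointInput ω ρ)).trans (by rw [trace_jointInput, hρ, mul_one])

variable [∀ i, DecidableEq (A' i)]

theorem ePPT_eq_iInf (N : Op (∀ i, A i) →ₗ[ℂ] Op (∀ i, A' i)) (ρ : Op (∀ i, Ahat i)) : ePPT N ρ =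
    ⨅ P : {P : Op (∀ i, A i × Ahat i) →ₗ[ℂ] Op (∀ i, A' i) // IsCPPTP P}, simError N ρ P.1 :=
  congrArg sInf <| Set.ext fun _ =>
    ⟨fun ⟨P, hP, he⟩ => ⟨⟨P, hP⟩, he.symm⟩, fun ⟨P, he⟩ => ⟨P.1, P.2, he.symm⟩⟩

theorem isGLB_ePPT (N : Op (∀ i, A i) →ₗ[ℂ] Op (∀ i, A' i)) (ρ : Op (∀ i, Ahat i))
    (h : ∃ P : Op (∀ i, A i × Ahat i) →ₗ[ℂ] Op (∀ i, A' i), IsCPPTP P) :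
    IsGLB (Set.range fun P : {P : Op (∀ i, A i × Ahat i) →ₗ[ℂ] Op (∀ i, A' i) // IsCPPTP P} =>
      simError N ρ P.1) (ePPT N ρ) := by
  have := nonempty_subtype.2 h
  rw [ePPT_eq_iInf]
  refine isGLB_ciInf ⟨0, ?_⟩
  rintro _ ⟨P, rfl⟩
  exact mul_nonneg one_half_pos.le (diamondDist_nonneg _ _)

variable [∀ i, DecidableEq (A i)]

theorem isGLB_simError {N : Op (∀ i, A i) →ₗ[ℂ] Op (∀ i, A' i)} {ρ : Op (∀ i, Ahat i)}
    (hN : IsHermitianPreserving N) (hNtr : IsTracePreserving N)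
    (hρ : ρ.IsHermitian) (hρtr : ρ.trace = 1)
    {P : Op (∀ i, A i × Ahat i) →ₗ[ℂ] Op (∀ i, A' i)} (hP : IsChannel P) :
    IsGLB {μ | 0 ≤ μ ∧ ∃ Z, IsDiamondCertificate (choi (N - simulation P ρ)) μ Z}
      (simError N ρ P) :=
  isGLB_half_diamondDist
    (hN.sub (simulation_isHermitianPreserving hP.1.isHermitianPreserving hρ)) fun X => by
      rw [LinearMap.sub_apply, trace_sub, hNtr, simulation_isTracePreserving hP.2 hρtr, sub_self]

theorem contractResource_apply (ρ : Op (∀ i, Ahat i)) (P : Op ((∀ i, A i × Ahat i) × (∀ i, A' i)))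
    (p q : (∀ i, A i) × (∀ i, A' i)) :
    contractResource ρ P p q = ∑ h, ∑ k, ρ k h *
      P ((Equiv.arrowProdEquivProdArrow ι A Ahat).symm (p.1, k), p.2)
        ((Equiv.arrowProdEquivProdArrow ι A Ahat).symm (q.1, h), q.2) := by
  simp only [contractResource, of_apply, mul_apply, kroneckerMap_apply, Fintype.sum_prod_type,
    one_apply, transpose_apply, submatrix_apply, ite_mul, one_mul, zero_mul, mul_ite, mul_one,
    mul_zero, Finset.sum_ite_irrel, Finset.sum_const_zero, Finset.sum_ite_eq, Finset.mem_univ,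
    if_true]
  rfl

variable [∀ i, DecidableEq (Ahat i)]

theorem choi_simulation (P : Op (∀ i, A i × Ahat i) →ₗ[ℂ] Op (∀ i, A' i))
    (ρ : Op (∀ i, Ahat i)) : choi (simulation P ρ) = contractResource ρ (choi P) := by
  ext p q
  let e := Equiv.arrowProdEquivProdArrow ι A Ahat
  have hsim : simulation P ρ (Matrix.single p.1 q.1 1) p.2 q.2 =
    P (jointInput (Matrix.single p.1 q.1 1) ρ) p.2 q.2 := rfl
  rw [choi_apply, contractResource_apply, hsim, apply_eq_sum_choi, ← e.symm.sum_comp,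
    Fintype.sum_prod_type]
  simp_rw [← e.symm.sum_comp (fun b => jointInput _ ρ _ b * _), Fintype.sum_prod_type]
  simp only [jointInput, submatrix_apply, e, Equiv.apply_symm_apply, kroneckerMap_apply,
    single_apply, ite_and, ite_mul, one_mul, zero_mul, Finset.sum_ite_irrel,
    Finset.sum_const_zero, Finset.sum_ite_eq, Finset.mem_univ, if_true]
  exact Finset.sum_comm

variable {N : Op (∀ i, A i) →ₗ[ℂ] Op (∀ i, A' i)} {ρ : Op (∀ i, Ahat i)}

theorem sdpFeasible_choi_iff {μ : ℝ} {Z : Op ((∀ i, A i) × (∀ i, A' i))}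
    (P : Op (∀ i, A i × Ahat i) →ₗ[ℂ] Op (∀ i, A' i)) :
    SDPFeasible N ρ μ Z (choi P) ↔
      IsCPPTP P ∧ 0 ≤ μ ∧ IsDiamondCertificate (choi (N - simulation P ρ)) μ Z := by
  rw [isCPPTP_iff_choi, choi_sub, choi_simulation]
  exact ⟨fun h => ⟨⟨h.P_nonneg, h.trace_eq, h.ppt⟩, h.mu_nonneg, h.Z_nonneg, h.diff_le, h.trace_le⟩,
    fun ⟨⟨hP, htr, hppt⟩, hμ, hZ⟩ =>
      ⟨hμ, hZ.posSemidef, hP, hZ.traceSnd_le, htr, hZ.sub_posSemidef, hppt⟩⟩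

theorem setOf_sdpFeasible_eq_iUnion :
    {μ : ℝ | ∃ Z P, SDPFeasible N ρ μ Z P} =
      ⋃ P : {P : Op (∀ i, A i × Ahat i) →ₗ[ℂ] Op (∀ i, A' i) // IsCPPTP P},
        {μ | 0 ≤ μ ∧ ∃ Z, IsDiamondCertificate (choi (N - simulation P.1 ρ)) μ Z} := by
  ext μ
  simp only [Set.mem_ofPred_eq, Set.mem_iUnion, Subtype.exists]
  constructor
  · rintro ⟨Z, J, h⟩
    rw [← choi_ofChoi J, sdpFeasible_choi_iff] at h
    exact ⟨ofChoi J, h.1, h.2.1, Z, h.2.2⟩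
  · rintro ⟨P, hP, hμ, Z, hZ⟩
    exact ⟨Z, choi P, (sdpFeasible_choi_iff P).2 ⟨hP, hμ, hZ⟩⟩

end Simulation

end ChannelSim

open ChannelSim in
theorem mainTheorem10_general {ι : Type*} [Fintype ι] [DecidableEq ι] {A Ahat A' : ι → Type*}
    [∀ i, Fintype (A i)] [∀ i, Fintype (Ahat i)] [∀ i, Fintype (A' i)]
    [∀ i, DecidableEq (A i)] [∀ i, DecidableEq (Ahat i)] [∀ i, DecidableEq (A' i)]
    (N : Op (∀ i, A i) →ₗ[ℂ] Op (∀ i, A' i)) (ρ : Op (∀ i, Ahat i))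
    (hN : IsHermitianPreserving N) (hN_trace : IsTracePreserving N)
    (hρ : ρ.IsHermitian) (hρ_trace : ρ.trace = 1) :
    {μ : ℝ | ∃ Z P, SDPFeasible N ρ μ Z P}.Nonempty ∧
      ePPT N ρ = sInf {μ : ℝ | ∃ Z P, SDPFeasible N ρ μ Z P} := by
  obtain ⟨P, hP⟩ : ∃ P : Op (∀ i, A i × Ahat i) →ₗ[ℂ] Op (∀ i, A' i), IsCPPTP P :=
    exists_isCPPTP fun ⟨x⟩ => hN_trace.nonempty ⟨fun i => (x i).1⟩
  have hGLB := (isGLB_iUnion_iff_of_isGLB (fun P : {P // IsCPPTP P} =>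
    isGLB_simError hN hN_trace hρ hρ_trace P.2.1) _).1 (isGLB_ePPT N ρ ⟨P, hP⟩)
  rw [← setOf_sdpFeasible_eq_iUnion] at hGLB
  have hne : {μ : ℝ | ∃ Z P, SDPFeasible N ρ μ Z P}.Nonempty := by
    obtain ⟨μ, Z, hμ, hZ⟩ := exists_isDiamondCertificate <| (isHermitianPreserving_iff_choi _).1 <|
      hN.sub (simulation_isHermitianPreserving hP.1.1.isHermitianPreserving hρ)
    exact ⟨μ, Z, choi P, (sdpFeasible_choi_iff P).2 ⟨hP, hμ, hZ⟩⟩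
  exact ⟨hne, (hGLB.csInf_eq hne).symm⟩

theorem mainTheorem10 {ι : Type*} [Fintype ι] [DecidableEq ι] {A Ahat A' : ι → Type*}
    [∀ i, Fintype (A i)] [∀ i, Fintype (Ahat i)] [∀ i, Fintype (A' i)]
    [∀ i, DecidableEq (A i)] [∀ i, DecidableEq (Ahat i)] [∀ i, DecidableEq (A' i)]
    (N : ChannelSim.Op (∀ i, A i) →ₗ[ℂ] ChannelSim.Op (∀ i, A' i))
    (ρ : ChannelSim.Op (∀ i, Ahat i))
    (hN : ChannelSim.IsChannel N) (hρ : ChannelSim.IsState ρ) :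
    {μ : ℝ | ∃ Z P, ChannelSim.SDPFeasible N ρ μ Z P}.Nonempty ∧
      ChannelSim.ePPT N ρ = sInf {μ : ℝ | ∃ Z P, ChannelSim.SDPFeasible N ρ μ Z P} :=
  mainTheorem10_general N ρ hN.1.isHermitianPreserving hN.2 hρ.1.isHermitian hρ.2
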